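/- Let $N=(n_1,n_2,\dots)$ be a sequence of integers $n_j\ge 2$ and let $\Sigma_N=\{\langle z_j\rangle_{j\ge1}\in\prod_{j\ge 1} S^1 : z_j=z_{j+1}^{n_j}\text{ for all }j\}$ be the corresponding solenoid, a compact abelian topological group (written additively). Let $\pi_N:\mathbb R\to\Sigma_N$, $\pi_N(t)=\langle e^{2\pi i t},e^{2\pi i t/n_1},e^{2\pi i t/(n_1n_2)},\dots\rangle$, an injective continuous homomorphism. A flow on $\Sigma_N$ is a continuous action $\phi$ of $(\mathbb R,+)$; for $x\in\Sigma_N$ the orbit of $x$ stays in the arc component $\pi_N(\mathbb R)+x$, and we put $c_x(t)=(\pi_N+x)^{-1}(\phi(t,x))\in\mathbb R$ and, where it exists, $v_\phi^j(x)=\frac{d^j}{dt^j}c_x(t)\big|_{t=0}$; $v_\phi=v_\phi^1$ is the vector field of $\phi$. Let $k\in\{0,1,2,\dots,\infty\}$ and $0\le\alpha\le1$. The flow $\phi$ is of class $C^{k+1+\alpha}$ if the functions $v_\phi^j$ exist and are continuous on $\Sigma_N$ for all (finite) $1\le j\le k+1$ and, in case $k<\infty$ and $\alpha>0$, for each $x\in\Sigma_N$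 the function $t\mapsto v_\phi^{k+1}(x+\pi_N(t))$ is $\alpha$-Hölder on $\mathbb R$. Let $C^{k+\alpha}(N+)$ be the space of $C^{k+1+\alpha}$ flows with $v_\phi>0$ everywhere (identified with their vector fields). With $$d_r(v_\phi,v_\psi)=\sum_{j=1}^{r}\max_{x\in\Sigma_N}|v^j_\phi(x)-v^j_\psi(x)|,\qquad d_\infty(v_\phi,v_\psi)=\sum_{r=1}^\infty\frac{2^{-r}d_r(v_\phi,v_\psi)}{1+d_r(v_\phi,v_\psi)},$$ endow $C^{k+\alpha}(N+)$ with the metric $d_{k+1}$ if $k<\infty$ and $d_\infty$ if $k=\infty$. A flow $\phi$ on $\Sigma_N$ is almost periodic if for every entourage $U$ of the uniformity of the compact space $\Sigma_N$ (equivalently, for every $\varepsilon>0$, with respect to a compatible metric) the set of $\tau\in\mathbb R$ such that $(x,\phi(\tau,x))\in U$ (resp. $d(x,\phi(\tau,x))<\varepsilon$) for all $x\in\Sigma_N$ is relatively dense in $\mathbb R$, i.e. meets every interval of some fixed length $L$. Then, for every such $N$, $k$ and $\alpha$, the almost periodic flows are dense in $C^{k+\alpha}(N+)$. -/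

import Mathlib

open scoped NNReal Uniformity

noncomputable section

namespace SolenoidFlow

/-- A sequence `N = (n₁, n₂, …)` of integers `≥ 2`, indexed from `0`: `N.n j` is `n_{j+1}`. -/
structure BondSeq where
  n : ℕ → ℕ
  two_le : ∀ j, 2 ≤ n j

/-- The solenoid `Σ_N`: the inverse limit of circles under `z ↦ z ^ n_j`, as a subgroup of the
product of countably many circles. The group operation is written multiplicatively. -/
def solenoid (N : BondSeq) : Subgroup (ℕ → Circle) where
  carrier := {z | ∀ j, z j = z (j + 1) ^ N.n j}
  mul_mem' := by
    intro a b ha hb j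
    simp only [Pi.mul_apply, mul_pow]
    rw [ha j, hb j]
  one_mem' := by
    intro j
    simp
  inv_mem' := by
    intro a ha j
    simp only [Pi.inv_apply, inv_pow]
    rw [ha j]

/-- The solenoid as a compact topological group (topology and uniformity of the product). -/
abbrev Sol (N : BondSeq) : Type := solenoid N

/-- The homomorphism `π_N : ℝ → Σ_N`,
`t ↦ ⟨exp (2πit), exp (2πit / n₁), …, exp (2πit / (n₁ ⋯ n_j)), …⟩`. -/
def line (N : BondSeq) (t : ℝ) : Sol N :=
  ⟨fun j => Circle.exp (2 * Real.pi * t / ((∏ i ∈ Finset.range j, N.n i : ℕ) : ℝ)), by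
    intro j
    have h : (N.n j : ℝ) ≠ 0 := by
      have := N.two_le j
      exact_mod_cast (by omega : N.n j ≠ 0)
    have hP : ((∏ i ∈ Finset.range j, N.n i : ℕ) : ℝ) ≠ 0 := by
      have : ∏ i ∈ Finset.range j, N.n i ≠ 0 :=
        Finset.prod_ne_zero_iff.2 fun i _ => by have := N.two_le i; omega
      exact_mod_cast this
    rw [← Circle.exp_nsmul, Finset.prod_range_succ]
    push_cast at hP ⊢
    rw [nsmul_eq_mul]
    field_simp⟩

/-- `(π_N + x)⁻¹ (φ (t, x))`: the position at time `t`, on the arc component of `x` parameterized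
by the injective map `s ↦ π_N s + x`, of the point which starts at `x` and moves along `φ`. -/
def orbitCoord {N : BondSeq} (φ : Flow ℝ (Sol N)) (x : Sol N) (t : ℝ) : ℝ :=
  Function.invFun (fun s : ℝ => line N s * x) (φ t x)

/-- `v_φ^j`: the `j`-th derivative of the orbit coordinate at time `0`. -/
def vf {N : BondSeq} (φ : Flow ℝ (Sol N)) (j : ℕ) (x : Sol N) : ℝ :=
  iteratedDeriv j (orbitCoord φ x) 0

/-- `φ` is a `C^{k+1+α}` flow, that is, its vector field `v_φ = v_φ^1` is of class `C^{k+α}`: the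
time derivatives of the orbit coordinates exist up to order `k + 1`, the functions
`v_φ^1, …, v_φ^{k+1}` are continuous, and, if `k < ∞` and `α > 0`, the function `v_φ^{k+1}` is
`α`-Hölder along every arc component. (By the group law, differentiability at time `0` for all
starting points is the same as differentiability at all times.) -/
structure IsSmooth {N : BondSeq} (k : ℕ∞) (α : ℝ≥0) (φ : Flow ℝ (Sol N)) : Prop where
  differentiable : ∀ j : ℕ, (j : ℕ∞) ≤ k → ∀ x, Differentiable ℝ (iteratedDeriv j (orbitCoord φ x))
  continuous : ∀ j : ℕ, (j : ℕ∞) ≤ k → Continuous (vf φ (j + 1))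
  holder : ∀ m : ℕ, k = m → 0 < α →
    ∀ x, ∃ C : ℝ≥0, HolderWith C α (fun t : ℝ => vf φ (m + 1) (x * line N t))

/-- `C^{k+α}(N+)`: the `C^{k+1+α}` flows on `Σ_N` with positive vector field. -/
structure PosFlow (N : BondSeq) (k : ℕ∞) (α : ℝ≥0) where
  flow : Flow ℝ (Sol N)
  smooth : IsSmooth k α flow
  pos : ∀ x, 0 < vf flow 1 x

/-- `d_r = ∑_{j=1}^{r} max_x |v_φ^j x - v_ψ^j x|`. -/
def dFin {N : BondSeq} (r : ℕ) (φ ψ : Flow ℝ (Sol N)) : ℝ :=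
  ∑ j ∈ Finset.Icc 1 r, ⨆ x : Sol N, |vf φ j x - vf ψ j x|

/-- `d_∞ = ∑_{r=1}^{∞} 2^{-r} d_r / (1 + d_r)`. -/
def dInf {N : BondSeq} (φ ψ : Flow ℝ (Sol N)) : ℝ :=
  ∑' r : ℕ, (1 / 2 : ℝ) ^ (r + 1) * (dFin (r + 1) φ ψ / (1 + dFin (r + 1) φ ψ))

/-- The distance on `C^{k+α}(N+)`. For finite `k` it compares all of `v^1, …, v^{k+1}`, the
derivatives that a `C^{k+1+α}` flow has. -/
def posDist {N : BondSeq} (k : ℕ∞) (φ ψ : Flow ℝ (Sol N)) : ℝ :=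
  if k = ⊤ then dInf φ ψ else dFin (k.toNat + 1) φ ψ

instance (N : BondSeq) : CompactSpace (Sol N) := by
  have hc : IsClosed ((solenoid N : Subgroup (ℕ → Circle)) : Set (ℕ → Circle)) := by
    have : ((solenoid N : Subgroup (ℕ → Circle)) : Set (ℕ → Circle))
        = ⋂ j, {z | z j = z (j + 1) ^ N.n j} := by
      ext z
      simp only [Set.mem_iInter, Set.mem_ofPred_eq]
      rfl
    rw [this]
    exact isClosed_iInter fun j => isClosed_eq (by fun_prop) (by fun_prop)
  exact isCompact_iff_compactSpace.1 hc.isCompact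

theorem dFin_self {N : BondSeq} (r : ℕ) (φ : Flow ℝ (Sol N)) : dFin r φ φ = 0 := by
  simp [dFin]

theorem dFin_comm {N : BondSeq} (r : ℕ) (φ ψ : Flow ℝ (Sol N)) : dFin r φ ψ = dFin r ψ φ := by
  simp only [dFin, abs_sub_comm]

theorem dFin_nonneg {N : BondSeq} (r : ℕ) (φ ψ : Flow ℝ (Sol N)) : 0 ≤ dFin r φ ψ :=
  Finset.sum_nonneg fun _ _ => Real.iSup_nonneg fun _ => abs_nonneg _

theorem dFin_triangle {N : BondSeq} {k : ℕ∞} {α : ℝ≥0} (φ ψ χ : PosFlow N k α) (r : ℕ)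
    (hr : ∀ j : ℕ, j + 1 ≤ r → (j : ℕ∞) ≤ k) :
    dFin r φ.flow χ.flow ≤ dFin r φ.flow ψ.flow + dFin r ψ.flow χ.flow := by
  have hb : ∀ (a b : PosFlow N k α) (j : ℕ), (j : ℕ∞) ≤ k →
      BddAbove (Set.range fun x => |vf a.flow (j + 1) x - vf b.flow (j + 1) x|) := fun a b j hj =>
    (isCompact_range ((a.smooth.continuous j hj).sub (b.smooth.continuous j hj)).abs).bddAbove
  simp only [dFin]
  rw [← Finset.sum_add_distrib]
  refine Finset.sum_le_sum fun j hj => ?_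
  obtain ⟨h1, h2⟩ := Finset.mem_Icc.1 hj
  obtain ⟨i, rfl⟩ : ∃ i, j = i + 1 := ⟨j - 1, by omega⟩
  have hi := hr i h2
  refine ciSup_le fun x => (abs_sub_le _ (vf ψ.flow (i + 1) x) _).trans ?_
  exact add_le_add (le_ciSup (hb φ ψ i hi) x) (le_ciSup (hb ψ χ i hi) x)

theorem dInf_summable {N : BondSeq} (φ ψ : Flow ℝ (Sol N)) : Summable fun r : ℕ =>
    (1 / 2 : ℝ) ^ (r + 1) * (dFin (r + 1) φ ψ / (1 + dFin (r + 1) φ ψ)) := by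
  have hs : Summable fun r : ℕ => (1 / 2 : ℝ) ^ (r + 1) :=
    (summable_nat_add_iff 1).2 summable_geometric_two
  refine Summable.of_nonneg_of_le (fun r => ?_) (fun r => ?_) hs
  · have := dFin_nonneg (r + 1) φ ψ
    positivity
  · have := dFin_nonneg (r + 1) φ ψ
    refine mul_le_of_le_one_right (by positivity) ?_
    rw [div_le_one (by linarith)]
    linarith

theorem bounded_triangle {a b c : ℝ} (ha : 0 ≤ a) (hb : 0 ≤ b) (hc : 0 ≤ c) (h : a ≤ b + c) :
    a / (1 + a) ≤ b / (1 + b) + c / (1 + c) := by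
  rw [div_add_div _ _ (by positivity) (by positivity), div_le_div_iff₀ (by positivity)
    (by positivity)]
  nlinarith [mul_nonneg hb hc, mul_nonneg (mul_nonneg ha hb) hc]

instance (N : BondSeq) (k : ℕ∞) (α : ℝ≥0) : PseudoMetricSpace (PosFlow N k α) where
  dist φ ψ := posDist k φ.flow ψ.flow
  dist_self φ := by
    simp [posDist, dInf, dFin_self]
  dist_comm φ ψ := by
    simp only [posDist, dInf, dFin_comm]
  dist_triangle φ ψ χ := by
    simp only [posDist]
    split_ifs with hk
    · simp only [dInf]
      rw [← (dInf_summable _ _).tsum_add (dInf_summable _ _)]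
      refine (dInf_summable _ _).tsum_le_tsum (fun r => ?_)
        ((dInf_summable _ _).add (dInf_summable _ _))
      rw [← mul_add]
      refine mul_le_mul_of_nonneg_left ?_ (by positivity)
      exact bounded_triangle (dFin_nonneg _ _ _) (dFin_nonneg _ _ _) (dFin_nonneg _ _ _)
        (dFin_triangle φ ψ χ _ fun j _ => by rw [hk]; exact le_top)
    · refine dFin_triangle φ ψ χ _ fun j hj => ?_
      rw [← ENat.natCast_toNat hk]
      exact_mod_cast Nat.le_of_succ_le_succ hj

/-- A flow on the solenoid is almost periodic if, for every entourage `U` of the (unique)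
uniformity of the compact space, the set of times `τ` which move every point by less than `U` is
relatively dense in `ℝ`. -/
def AlmostPeriodic {N : BondSeq} (φ : Flow ℝ (Sol N)) : Prop :=
  ∀ U ∈ 𝓤 (Sol N), ∃ L : ℝ, 0 < L ∧ ∀ a : ℝ, ∃ τ ∈ Set.Icc a (a + L), ∀ x, (x, φ τ x) ∈ U

end SolenoidFlow

end

/-!
The arc components of the solenoid are the cosets of the one-parameter subgroup `line`, and a flow
with positive vector field `v` moves along them (`exists_eq_line_mul`): it is a time change of the
linear flow. Its higher vector fields arise from `v` by iterating `u ↦ v ∂u`, where `∂` is the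
derivative along the arc components (`IsLeafFlow.vf_succ`). Conversely, by the inverse function
theorem, a `C^{k+1}` flow has a vector field which is `k` times differentiable along the arc
components with continuous derivatives (`PosFlow.leafC`). So it is enough to
approximate `v`, in `C^k` along the arc components, by velocities `w` of almost periodic flows.

For this `v` is convolved, with respect to Haar measure, with a kernel which is concentrated near
the identity and depends on a single coordinate. Convolution commutes with `∂`, so it approximates
`v` together with its derivatives (`LeafC.leafTendsto_conv`). It also gains a derivative
(`LeafC.conv`), which makes the last vector field Lipschitz and bounded, hence Hölder for every
exponent `α ≤ 1` (`IsLeafFlow.isSmooth`). The result `w` depends on a single coordinate again.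

Along the one-parameter subgroup such a `w > 0` is periodic, with period `P` say. The travel time
`T t = ∫ 1 / w` over `[0, t]` satisfies `T (t + P) = T t + T P`, so a multiple `θ` of `T` commutes
with the translation by `P` and induces a homeomorphism of the solenoid. This homeomorphism
conjugates the flow with velocity `w` to a linear flow (`exists_almostPeriodic_isLeafFlow`). Linear
flows are almost periodic because the translation by the period of a coordinate fixes this
coordinate and all earlier ones, and almost periodicity passes through a uniformly continuous
conjugacy (`almostPeriodic_conjFlow`).
-/

noncomputable section

namespace SolenoidFlow

open Filter Topology MeasureTheory Measure

variable {N : BondSeq}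

/-! ### The one-parameter subgroup and the coordinates -/

/-- `n₁ ⋯ n_m`, the period of the `m`-th coordinate along the one-parameter subgroup. -/
def period (N : BondSeq) (m : ℕ) : ℝ := ((∏ i ∈ Finset.range m, N.n i : ℕ) : ℝ)

theorem period_succ (m : ℕ) : period N (m + 1) = period N m * N.n m := by
  simp [period, Finset.prod_range_succ]

theorem two_pow_le_period (m : ℕ) : (2 : ℝ) ^ m ≤ period N m := by
  induction m with
  | zero => simp [period]
  | succ m ih =>
    rw [period_succ, pow_succ]
    have : (2 : ℝ) ≤ N.n m := by exact_mod_cast N.two_le m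
    exact mul_le_mul ih this (by norm_num) ((by positivity : (0 : ℝ) ≤ 2 ^ m).trans ih)

theorem period_pos (m : ℕ) : 0 < period N m := lt_of_lt_of_le (by positivity) (two_pow_le_period m)

theorem line_apply (t : ℝ) (m : ℕ) :
    (line N t).1 m = Circle.exp (2 * Real.pi * t / period N m) := rfl

theorem continuous_line : Continuous (line N) := by
  refine Continuous.subtype_mk (continuous_pi fun j => ?_) _
  exact Circle.exp.continuous.comp (by fun_prop)

theorem line_zero : line N 0 = 1 := by
  ext j; simp [line]

theorem line_add (s t : ℝ) : line N (s + t) = line N s * line N t := by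
  refine Subtype.ext (funext fun j => ?_)
  change (line N (s + t)).1 j = (line N s).1 j * (line N t).1 j
  rw [line_apply, line_apply, line_apply, ← Circle.exp_add]
  congr 1; ring

theorem line_neg (s : ℝ) : line N (-s) = (line N s)⁻¹ := by
  rw [eq_inv_iff_mul_eq_one, ← line_add, neg_add_cancel, line_zero]

theorem circleExp_eq_iff {s t P : ℝ} (hP : 0 < P) :
    Circle.exp (2 * Real.pi * s / P) = Circle.exp (2 * Real.pi * t / P) ↔
      ∃ n : ℤ, s = t + n * P := by
  rw [Circle.exp_eq_exp]
  refine exists_congr fun n => ?_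
  have := Real.pi_pos
  constructor
  · intro h; field_simp at h; linarith
  · rintro rfl; field_simp

theorem line_injective : Function.Injective (line N) := by
  intro s t h
  obtain ⟨m, hm⟩ := pow_unbounded_of_one_lt |s - t| (one_lt_two (α := ℝ))
  have h1 : (line N s).1 m = (line N t).1 m := by rw [h]
  rw [line_apply, line_apply, circleExp_eq_iff (period_pos m)] at h1
  obtain ⟨n, hn⟩ := h1
  have h2 : |(n : ℝ)| * period N m = |s - t| := by
    rw [hn, add_sub_cancel_left, abs_mul, abs_of_pos (period_pos m)]
  -- `s - t` is a multiple of a period which exceeds `|s - t|`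
  have h3 : |n| < 1 := by
    by_contra! h4
    have h5 : (1 : ℝ) ≤ |(n : ℝ)| := by exact_mod_cast h4
    nlinarith [two_pow_le_period (N := N) m, period_pos (N := N) m]
  rw [Int.abs_lt_one_iff.1 h3] at hn
  simpa using hn

theorem line_mul_injective (x : Sol N) : Function.Injective fun s => line N s * x :=
  fun _ _ h => line_injective (mul_right_cancel h)

/-- The `m`-th coordinate, as a homomorphism. -/
def coord (N : BondSeq) (m : ℕ) : Sol N →* Circle :=
  (Pi.evalMonoidHom (fun _ : ℕ => Circle) m).comp (solenoid N).subtype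

theorem continuous_coord (m : ℕ) : Continuous (coord N m) :=
  (continuous_apply m).comp continuous_subtype_val

theorem coord_line (m : ℕ) (t : ℝ) :
    coord N m (line N t) = Circle.exp (2 * Real.pi * t / period N m) := rfl

theorem coord_succ (m : ℕ) (x : Sol N) : coord N m x = coord N (m + 1) x ^ N.n m := x.2 m

theorem coord_line_eq_iff {m : ℕ} {s t : ℝ} :
    coord N m (line N s) = coord N m (line N t) ↔ ∃ n : ℤ, s = t + n * period N m :=
  circleExp_eq_iff (period_pos m)

/-- Every point is the product of a point of the one-parameter subgroup and a point of the kernel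
of a given coordinate: the solenoid is a suspension over that kernel. -/
theorem exists_line_mul (m : ℕ) (x : Sol N) : ∃ t κ, coord N m κ = 1 ∧ x = line N t * κ := by
  obtain ⟨θ, hθ⟩ : ∃ θ, Circle.exp θ = coord N m x := ⟨_, Circle.exp_arg _⟩
  refine ⟨θ * period N m / (2 * Real.pi),
    (line N (θ * period N m / (2 * Real.pi)))⁻¹ * x, ?_, ?_⟩
  · have := Real.pi_pos
    have := period_pos (N := N) m
    rw [map_mul, map_inv, coord_line, ← hθ, inv_mul_eq_one]
    congr 1; field_simp
  · simp

/-- A single coordinate detects proximity to the identity, since each coordinate is a power of the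
next one. -/
theorem exists_coord_mem_of_mem_nhds_one {U : Set (Sol N)} (hU : U ∈ 𝓝 (1 : Sol N)) :
    ∃ m, ∃ W ∈ 𝓝 (1 : Circle), ∀ x, coord N m x ∈ W → x ∈ U := by
  have hanti : ∀ i j, i ≤ j → comap (coord N j) (𝓝 1) ≤ comap (coord N i) (𝓝 1) := by
    intro i j hij
    induction j, hij using Nat.le_induction with
    | base => exact le_rfl
    | succ j _ ih =>
      refine le_trans ?_ ih
      have hc : (coord N j : Sol N → Circle) = (fun z => z ^ N.n j) ∘ coord N (j + 1) :=
        funext (coord_succ j)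
      rw [hc, ← Filter.comap_comap]
      refine comap_mono (map_le_iff_le_comap.1 ?_)
      have : Tendsto (fun z : Circle => z ^ N.n j) (𝓝 1) (𝓝 (1 ^ N.n j)) :=
        (continuous_pow _).tendsto 1
      rwa [one_pow] at this
  have h1 : 𝓝 (1 : Sol N) = ⨅ j, comap (coord N j) (𝓝 1) := by
    rw [nhds_subtype_eq_comap, nhds_pi, Filter.pi, comap_iInf]
    simp only [Filter.comap_comap]
    rfl
  rw [h1, mem_iInf_of_directed (directed_of_isDirected_le fun i j h => hanti i j h)] at hU
  obtain ⟨m, W, hW, hWU⟩ := hU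
  exact ⟨m, W, hW, fun x hx => hWU hx⟩

/-! ### Differentiation along the leaves -/

/-- `u'` is the derivative of `u` along the arc components. Differentiability at parameter `0` for
all base points amounts to differentiability everywhere, see `LeafDeriv.hasDerivAt`. -/
def LeafDeriv (u u' : C(Sol N, ℝ)) : Prop :=
  ∀ x, HasDerivAt (fun s => u (x * line N s)) (u' x) 0

/-- `u` is `r` times continuously differentiable along the arc components, with derivatives which
are continuous on the solenoid. -/
def LeafC : ℕ → C(Sol N, ℝ) → Prop
  | 0, _ => True
  | r + 1, u => ∃ u', LeafDeriv u u' ∧ LeafC r u'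

/-- The sequence `u` converges to `U` in `C^r` along the arc components: the leaf derivatives up to
order `r` exist and converge uniformly. -/
def LeafTendsto : ℕ → (ℕ → C(Sol N, ℝ)) → C(Sol N, ℝ) → Prop
  | 0, u, U => Tendsto u atTop (𝓝 U)
  | r + 1, u, U => Tendsto u atTop (𝓝 U) ∧ ∃ u' U', (∀ n, LeafDeriv (u n) (u' n)) ∧
      LeafDeriv U U' ∧ LeafTendsto r u' U'

theorem LeafDeriv.hasDerivAt {u u' : C(Sol N, ℝ)} (h : LeafDeriv u u') (x : Sol N) (s : ℝ) :
    HasDerivAt (fun s => u (x * line N s)) (u' (x * line N s)) s := by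
  have h1 := h (x * line N s)
  rw [← sub_self s] at h1
  have h2 := h1.comp_sub_const (𝕜 := ℝ) s s
  refine h2.congr_of_eventuallyEq (Eventually.of_forall fun r => ?_)
  simp only [mul_assoc, ← line_add]
  congr 3; ring

theorem LeafDeriv.add {u u' w w' : C(Sol N, ℝ)} (hu : LeafDeriv u u') (hw : LeafDeriv w w') :
    LeafDeriv (u + w) (u' + w') := fun x => (hu x).add (hw x)

theorem LeafDeriv.mul {u u' w w' : C(Sol N, ℝ)} (hu : LeafDeriv u u') (hw : LeafDeriv w w') :
    LeafDeriv (u * w) (u' * w + u * w') := fun x => by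
  simpa [line_zero] using (hu x).fun_mul (hw x)

theorem LeafDeriv.neg {u u' : C(Sol N, ℝ)} (hu : LeafDeriv u u') : LeafDeriv (-u) (-u') :=
  fun x => (hu x).neg

theorem LeafDeriv.of_mul_eq_one {u u' w : C(Sol N, ℝ)} (hu : LeafDeriv u u') (h : u * w = 1) :
    LeafDeriv w (-(u' * (w * w))) := fun x => by
  have hx : ∀ y, u y * w y = 1 := fun y => by
    rw [← ContinuousMap.mul_apply, h, ContinuousMap.one_apply]
  have hw : ∀ y, w y = (u y)⁻¹ := fun y => eq_inv_of_mul_eq_one_right (hx y)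
  have h0 : u (x * line N 0) ≠ 0 := left_ne_zero_of_mul_eq_one (hx _)
  have h1 := (hu x).inv h0
  simp only [line_zero, mul_one] at h1
  refine (h1.congr_of_eventuallyEq (Eventually.of_forall fun s => hw _)).congr_deriv ?_
  simp only [ContinuousMap.neg_apply, ContinuousMap.mul_apply, hw]
  field_simp

theorem LeafC.of_succ {r : ℕ} {u : C(Sol N, ℝ)} (h : LeafC (r + 1) u) : LeafC r u := by
  induction r generalizing u with
  | zero => trivial
  | succ r ih =>
    obtain ⟨u', hu, hr⟩ := h
    exact ⟨u', hu, ih hr⟩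

theorem LeafC.add {r : ℕ} {u w : C(Sol N, ℝ)} (hu : LeafC r u) (hw : LeafC r w) :
    LeafC r (u + w) := by
  induction r generalizing u w with
  | zero => trivial
  | succ r ih =>
    obtain ⟨u', hu, hr⟩ := hu
    obtain ⟨w', hw, hs⟩ := hw
    exact ⟨_, hu.add hw, ih hr hs⟩

theorem LeafC.neg {r : ℕ} {u : C(Sol N, ℝ)} (hu : LeafC r u) : LeafC r (-u) := by
  induction r generalizing u with
  | zero => trivial
  | succ r ih =>
    obtain ⟨u', hu, hr⟩ := hu
    exact ⟨_, hu.neg, ih hr⟩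

theorem LeafC.mul {r : ℕ} {u w : C(Sol N, ℝ)} (hu : LeafC r u) (hw : LeafC r w) :
    LeafC r (u * w) := by
  induction r generalizing u w with
  | zero => trivial
  | succ r ih =>
    have hu0 := hu.of_succ
    have hw0 := hw.of_succ
    obtain ⟨u', hu, hr⟩ := hu
    obtain ⟨w', hw, hs⟩ := hw
    exact ⟨_, hu.mul hw, (ih hr hw0).add (ih hu0 hs)⟩

theorem LeafC.of_mul_eq_one {r : ℕ} {u w : C(Sol N, ℝ)} (hu : LeafC r u) (h : u * w = 1) :
    LeafC r w := by
  induction r with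
  | zero => trivial
  | succ r ih =>
    have hw := ih hu.of_succ
    obtain ⟨u', hu, hr⟩ := hu
    exact ⟨_, hu.of_mul_eq_one h, (hr.mul (hw.mul hw)).neg⟩

theorem LeafTendsto.tendsto {r : ℕ} {u : ℕ → C(Sol N, ℝ)} {U : C(Sol N, ℝ)}
    (h : LeafTendsto r u U) : Tendsto u atTop (𝓝 U) := by
  cases r with
  | zero => exact h
  | succ r => exact h.1

theorem LeafTendsto.of_succ {r : ℕ} {u : ℕ → C(Sol N, ℝ)} {U : C(Sol N, ℝ)}
    (h : LeafTendsto (r + 1) u U) : LeafTendsto r u U := by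
  induction r generalizing u U with
  | zero => exact h.1
  | succ r ih =>
    obtain ⟨h0, u', U', hu, hU, hr⟩ := h
    exact ⟨h0, u', U', hu, hU, ih hr⟩

theorem LeafTendsto.of_le {r q : ℕ} {u : ℕ → C(Sol N, ℝ)} {U : C(Sol N, ℝ)}
    (h : LeafTendsto r u U) (hq : q ≤ r) : LeafTendsto q u U := by
  induction r, hq using Nat.le_induction with
  | base => exact h
  | succ r _ ih => exact ih h.of_succ

theorem LeafTendsto.add {r : ℕ} {u w : ℕ → C(Sol N, ℝ)} {U W : C(Sol N, ℝ)}
    (hu : LeafTendsto r u U) (hw : LeafTendsto r w W) : LeafTendsto r (u + w) (U + W) := by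
  induction r generalizing u w U W with
  | zero => exact Tendsto.add hu hw
  | succ r ih =>
    obtain ⟨h0, u', U', hu, hU, hr⟩ := hu
    obtain ⟨h0', w', W', hw, hW, hs⟩ := hw
    exact ⟨h0.add h0', u' + w', U' + W', fun n => (hu n).add (hw n), hU.add hW, ih hr hs⟩

theorem LeafTendsto.mul {r : ℕ} {u w : ℕ → C(Sol N, ℝ)} {U W : C(Sol N, ℝ)}
    (hu : LeafTendsto r u U) (hw : LeafTendsto r w W) : LeafTendsto r (u * w) (U * W) := by
  induction r generalizing u w U W with
  | zero => exact Tendsto.mul hu hw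
  | succ r ih =>
    have hu0 := hu.of_succ
    have hw0 := hw.of_succ
    obtain ⟨h0, u', U', hu, hU, hr⟩ := hu
    obtain ⟨h0', w', W', hw, hW, hs⟩ := hw
    exact ⟨h0.mul h0', u' * w + u * w', U' * W + U * W', fun n => (hu n).mul (hw n), hU.mul hW,
      (ih hr hw0).add (ih hu0 hs)⟩

/-! ### Flows along the leaves -/

/-- The flow `φ` moves every point along its arc component, with velocity `v`. -/
structure IsLeafFlow (φ : Flow ℝ (Sol N)) (v : C(Sol N, ℝ)) : Prop where
  eq : ∀ x t, φ t x = line N (orbitCoord φ x t) * x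
  hasDerivAt_zero : ∀ x, HasDerivAt (orbitCoord φ x) (v x) 0

theorem orbitCoord_eq {φ : Flow ℝ (Sol N)} {x : Sol N} {s t : ℝ} (h : φ t x = line N s * x) :
    orbitCoord φ x t = s := by
  rw [orbitCoord, h]
  exact Function.leftInverse_invFun (line_mul_injective x) s

theorem orbitCoord_zero (φ : Flow ℝ (Sol N)) (x : Sol N) : orbitCoord φ x 0 = 0 :=
  orbitCoord_eq (by rw [φ.map_zero_apply, line_zero, one_mul])

theorem line_orbitCoord {φ : Flow ℝ (Sol N)} {x : Sol N} {t : ℝ} (h : ∃ s, φ t x = line N s * x) :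
    φ t x = line N (orbitCoord φ x t) * x := by
  obtain ⟨s, hs⟩ := h
  rwa [orbitCoord_eq hs]

/-- A flow with nonzero vector field cannot leave the arc components. Off the arc component of `x`
the orbit coordinate has a constant junk value; a nonzero derivative at time `0` excludes that
value for small times, so that the times at which an orbit is in its arc component form a clopen
set. -/
theorem exists_eq_line_mul {φ : Flow ℝ (Sol N)} {v : Sol N → ℝ}
    (hd : ∀ x, HasDerivAt (orbitCoord φ x) (v x) 0) (hv : ∀ x, v x ≠ 0) (x : Sol N) (t : ℝ) :
    ∃ s, φ t x = line N s * x := by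
  have hloc : ∀ y, ∀ᶠ t in 𝓝 (0 : ℝ), ∃ s, φ t y = line N s * y := by
    intro y
    set J : ℝ := Classical.choice inferInstance with hJ
    have hjunk : ∀ t, (¬ ∃ s, φ t y = line N s * y) → orbitCoord φ y t = J := by
      intro t ht
      exact Function.invFun_neg fun ⟨s, hs⟩ => ht ⟨s, hs.symm⟩
    have h0 : ∃ s, φ 0 y = line N s * y := ⟨0, by rw [φ.map_zero_apply, line_zero, one_mul]⟩
    by_cases hJ0 : J = 0
    · have h1 := (hd y).eventually_ne (c := J) (hv y)
      rw [eventually_nhdsWithin_iff] at h1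
      filter_upwards [h1] with t ht
      by_contra hn
      exact ht (fun h => hn (h ▸ h0)) (hjunk t hn)
    · have h1 : ∀ᶠ t in 𝓝 (0 : ℝ), orbitCoord φ y t ≠ J := by
        refine (hd y).continuousAt.eventually_ne ?_
        rw [orbitCoord_zero]
        exact fun h => hJ0 h.symm
      filter_upwards [h1] with t ht
      by_contra hn
      exact ht (hjunk t hn)
  have hloc' : ∀ t, ∀ᶠ r in 𝓝 t, ∃ s, φ r x = line N s * φ t x := by
    intro t
    have h1 : Tendsto (fun r : ℝ => r - t) (𝓝 t) (𝓝 0) := by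
      rw [← sub_self t]; exact tendsto_id.sub_const t
    filter_upwards [h1.eventually (hloc (φ t x))] with r hr
    obtain ⟨s, hs⟩ := hr
    exact ⟨s, by rw [← hs, ← φ.map_add, sub_add_cancel]⟩
  have hclopen : IsClopen {t | ∃ s, φ t x = line N s * x} := by
    constructor
    · rw [← isOpen_compl_iff, isOpen_iff_mem_nhds]
      intro t ht
      filter_upwards [hloc' t] with r hr hr'
      obtain ⟨s, hs⟩ := hr
      obtain ⟨s', hs'⟩ := hr'
      refine ht ⟨-s + s', ?_⟩
      rw [line_add, mul_assoc, ← hs', hs, ← mul_assoc, line_neg, inv_mul_cancel, one_mul]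
    · rw [isOpen_iff_mem_nhds]
      rintro t ⟨s', hs'⟩
      filter_upwards [hloc' t] with r hr
      obtain ⟨s, hs⟩ := hr
      exact ⟨s + s', by rw [hs, hs', line_add, mul_assoc]⟩
  have huniv := hclopen.eq_univ ⟨0, 0, by rw [φ.map_zero_apply, line_zero, one_mul]⟩
  exact (Set.ext_iff.1 huniv t).2 trivial

theorem continuous_apply_left (φ : Flow ℝ (Sol N)) (x : Sol N) : Continuous fun t => φ t x :=
  φ.continuous continuous_id continuous_const

namespace IsLeafFlow

variable {φ : Flow ℝ (Sol N)} {v : C(Sol N, ℝ)}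

theorem orbitCoord_add (h : IsLeafFlow φ v) (x : Sol N) (t s : ℝ) :
    orbitCoord φ x (t + s) = orbitCoord φ x t + orbitCoord φ (φ t x) s := by
  apply orbitCoord_eq
  rw [add_comm t, φ.map_add, h.eq (φ t x) s, add_comm, line_add, mul_assoc, ← h.eq x t]

/-- The derivatives of an orbit coordinate at time `t` are those at time `0` of the orbit coordinate
based at the point reached; the shift by a constant forces positive order. -/
theorem iteratedDeriv_orbitCoord (h : IsLeafFlow φ v) (j : ℕ) (x : Sol N) (t : ℝ) :
    iteratedDeriv (j + 1) (orbitCoord φ x) t = vf φ (j + 1) (φ t x) := by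
  have h1 : (fun s => orbitCoord φ x (t + s)) =
      fun s => orbitCoord φ x t + orbitCoord φ (φ t x) s := funext (h.orbitCoord_add x t)
  have h2 := congrFun (iteratedDeriv_comp_const_add (j + 1) (orbitCoord φ x) t) 0
  rw [h1, iteratedDeriv_const_add j.succ_pos, add_zero] at h2
  exact h2.symm

theorem hasDerivAt (h : IsLeafFlow φ v) (x : Sol N) (t : ℝ) :
    HasDerivAt (orbitCoord φ x) (v (φ t x)) t := by
  have h1 := h.hasDerivAt_zero (φ t x)
  rw [← sub_self t] at h1
  refine ((h1.comp_sub_const t t).const_add (orbitCoord φ x t)).congr_of_eventuallyEq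
    (Eventually.of_forall fun r => ?_)
  beta_reduce
  rw [← h.orbitCoord_add, add_sub_cancel]

theorem vf_one (h : IsLeafFlow φ v) (x : Sol N) : vf φ 1 x = v x := by
  rw [vf, iteratedDeriv_one]
  exact (h.hasDerivAt_zero x).deriv

/-- Chain rule: the derivative along the flow is the velocity times the leaf derivative. -/
theorem hasDerivAt_comp (h : IsLeafFlow φ v) {u u' : C(Sol N, ℝ)} (hu : LeafDeriv u u')
    (x : Sol N) (t : ℝ) : HasDerivAt (fun t => u (φ t x)) ((v * u') (φ t x)) t := by
  have h1 := (hu.hasDerivAt x (orbitCoord φ x t)).comp t (h.hasDerivAt x t)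
  rw [mul_comm x, ← h.eq, mul_comm] at h1
  refine h1.congr_of_eventuallyEq (Eventually.of_forall fun r => ?_)
  simp only [Function.comp]
  rw [mul_comm x, ← h.eq]

/-- Converse of the chain rule, for a flow without rest points: the inverse of the orbit coordinate
is differentiable. -/
theorem leafDeriv (h : IsLeafFlow φ v) {w : C(Sol N, ℝ)} (hw : v * w = 1) {u u' : C(Sol N, ℝ)}
    (hu : ∀ x, HasDerivAt (fun t => u (φ t x)) (u' x) 0) : LeafDeriv u (u' * w) := by
  intro x
  have hvw : v x * w x = 1 := by
    rw [← ContinuousMap.mul_apply, hw, ContinuousMap.one_apply]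
  have hs : HasStrictDerivAt (orbitCoord φ x) (v (φ 0 x)) 0 :=
    hasStrictDerivAt_of_hasDerivAt_of_continuousAt (f' := fun t => v (φ t x))
      (Eventually.of_forall (h.hasDerivAt x))
      (v.continuous.comp (continuous_apply_left φ x)).continuousAt
  rw [φ.map_zero_apply] at hs
  have hv0 : v x ≠ 0 := left_ne_zero_of_mul_eq_one hvw
  have hσ := (hs.to_localInverse hv0).hasDerivAt
  have hr := hs.eventually_right_inverse hv0
  have hσ0 : hs.localInverse _ _ _ hv0 0 = 0 := by
    have := (hs.eventually_left_inverse hv0).self_of_nhds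
    rwa [orbitCoord_zero] at this
  rw [orbitCoord_zero] at hσ hr
  have hux := hu x
  rw [← hσ0] at hux
  have h1 := hux.comp 0 hσ
  refine (h1.congr_of_eventuallyEq ?_).congr_deriv ?_
  · filter_upwards [hr] with s hs'
    simp only [Function.comp]
    rw [h.eq, hs', mul_comm]
  · rw [ContinuousMap.mul_apply, eq_inv_of_mul_eq_one_right hvw]

/-- The higher vector fields of a leaf flow arise by iterating `u ↦ v ∂u`. -/
theorem vf_succ (h : IsLeafFlow φ v) {j : ℕ} {u u' : C(Sol N, ℝ)}
    (hj : ∀ x, vf φ (j + 1) x = u x) (hu : LeafDeriv u u') (x : Sol N) :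
    vf φ (j + 2) x = (v * u') x := by
  have h1 : iteratedDeriv (j + 1) (orbitCoord φ x) = fun t => u (φ t x) :=
    funext fun t => by rw [h.iteratedDeriv_orbitCoord, hj]
  rw [vf, iteratedDeriv_succ, h1, (h.hasDerivAt_comp hu x 0).deriv, φ.map_zero_apply]

theorem exists_vf_eq (h : IsLeafFlow φ v) {r : ℕ} (hv : LeafC r v) {j : ℕ} (hj : j ≤ r) :
    ∃ u : C(Sol N, ℝ), (∀ x, vf φ (j + 1) x = u x) ∧ LeafC (r - j) u := by
  induction j with
  | zero => exact ⟨v, h.vf_one, hv⟩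
  | succ j ih =>
    obtain ⟨u, hu, hur⟩ := ih (by omega)
    obtain ⟨q, hq⟩ : ∃ q, r - j = q + 1 := ⟨r - j - 1, by omega⟩
    rw [hq] at hur
    obtain ⟨u', huu', hr⟩ := hur
    have hvq : ∀ i, i ≤ r → LeafC i v := fun i hi => by
      induction hi using Nat.decreasingInduction with
      | self => exact hv
      | of_succ i _ ih => exact ih.of_succ
    refine ⟨v * u', h.vf_succ hu huu', ?_⟩
    rw [show r - (j + 1) = q by omega]
    exact (hvq q (by omega)).mul hr

end IsLeafFlow

/-- A function with a leaf derivative is Hölder along the leaves for every exponent in `(0, 1]`: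
it is bounded and Lipschitz. -/
theorem LeafDeriv.exists_holderWith {u u' : C(Sol N, ℝ)} (hu : LeafDeriv u u') {α : ℝ≥0}
    (hα : α ≤ 1) (x : Sol N) : ∃ C : ℝ≥0, HolderWith C α fun t => u (x * line N t) := by
  have hlip : LipschitzWith ‖u'‖₊ fun t => u (x * line N t) := by
    refine lipschitzWith_of_nnnorm_deriv_le (fun t => (hu.hasDerivAt x t).differentiableAt)
      fun t => ?_
    rw [(hu.hasDerivAt x t).deriv]
    exact u'.norm_coe_le_norm _
  refine ⟨max ‖u'‖₊ (2 * ‖u‖₊), fun s t => ?_⟩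
  rw [edist_nndist, edist_nndist, ← ENNReal.coe_rpow_of_nonneg _ α.coe_nonneg, ← ENNReal.coe_mul,
    ENNReal.coe_le_coe, ← NNReal.coe_le_coe, NNReal.coe_mul, NNReal.coe_rpow, coe_nndist,
    coe_nndist, NNReal.coe_max]
  rcases le_total (dist s t) 1 with h | h
  · refine (hlip.dist_le_mul s t).trans (mul_le_mul (le_max_left _ _) ?_ dist_nonneg
      (le_max_of_le_left (NNReal.coe_nonneg _)))
    exact Real.self_le_rpow_of_le_one dist_nonneg h (by exact_mod_cast hα)
  · have h1 : dist (u (x * line N s)) (u (x * line N t)) ≤ 2 * ‖u‖ := by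
      rw [two_mul]
      exact (dist_le_norm_add_norm _ _).trans (add_le_add (u.norm_coe_le_norm _)
        (u.norm_coe_le_norm _))
    refine (h1.trans (le_max_right _ _)).trans (le_mul_of_one_le_right
      (le_max_of_le_left (NNReal.coe_nonneg _)) (Real.one_le_rpow h α.2))

/-- A leaf flow whose velocity has one derivative more than needed is smooth; the last derivative
gives the Hölder condition. -/
theorem IsLeafFlow.isSmooth {φ : Flow ℝ (Sol N)} {v : C(Sol N, ℝ)} (h : IsLeafFlow φ v) {k : ℕ∞}
    (hv : ∀ r : ℕ, (r : ℕ∞) ≤ k → LeafC (r + 1) v) {α : ℝ≥0} (hα : α ≤ 1) : IsSmooth k α φ where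
  differentiable j hj x := by
    cases j with
    | zero =>
      rw [iteratedDeriv_zero]
      exact fun t => (h.hasDerivAt x t).differentiableAt
    | succ j =>
      obtain ⟨u, hu, hur⟩ := h.exists_vf_eq (hv _ hj) (j := j) (by omega)
      rw [show j + 1 + 1 - j = 1 + 1 by omega] at hur
      obtain ⟨u', huu', -⟩ := hur
      have h1 : iteratedDeriv (j + 1) (orbitCoord φ x) = fun t => u (φ t x) :=
        funext fun t => by rw [h.iteratedDeriv_orbitCoord, hu]
      rw [h1]
      exact fun t => (h.hasDerivAt_comp huu' x t).differentiableAt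
  continuous j hj := by
    obtain ⟨u, hu, -⟩ := h.exists_vf_eq (hv _ hj) (j := j) (by omega)
    rw [funext hu]
    exact u.continuous
  holder m hm _ x := by
    obtain ⟨u, hu, hur⟩ := h.exists_vf_eq (hv m hm.ge) (j := m) (by omega)
    rw [show m + 1 - m = 0 + 1 by omega] at hur
    obtain ⟨u', huu', -⟩ := hur
    simp only [hu]
    exact huu'.exists_holderWith hα x

namespace PosFlow

variable {k : ℕ∞} {α : ℝ≥0}

/-- The vector field `v_φ^{j+1}` as a continuous function. -/
def field (φ : PosFlow N k α) (j : ℕ) (hj : (j : ℕ∞) ≤ k) : C(Sol N, ℝ) :=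
  ⟨vf φ.flow (j + 1), φ.smooth.continuous j hj⟩

theorem isLeafFlow (φ : PosFlow N k α) : IsLeafFlow φ.flow (φ.field 0 bot_le) := by
  have h1 : ∀ x, HasDerivAt (orbitCoord φ.flow x) (φ.field 0 bot_le x) 0 := by
    intro x
    have h2 := φ.smooth.differentiable 0 bot_le x
    rw [iteratedDeriv_zero] at h2
    have h3 := (h2 0).hasDerivAt
    rwa [← iteratedDeriv_one] at h3
  exact ⟨fun x t => line_orbitCoord (exists_eq_line_mul h1 (fun x => (φ.pos x).ne') x t), h1⟩

/-- The vector field `v` of a `C^{k+1}` flow is `k` times continuously differentiable along the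
leaves: the leaf derivative of `v_φ^j` is `v_φ^{j+1} / v`. -/
theorem leafC (φ : PosFlow N k α) {r : ℕ} (hr : (r : ℕ∞) ≤ k) :
    LeafC r (φ.field 0 bot_le) := by
  have h := φ.isLeafFlow
  have hpos : ∀ x, 0 < φ.field 0 bot_le x := φ.pos
  let w : C(Sol N, ℝ) :=
    ⟨fun x => (φ.field 0 bot_le x)⁻¹, (φ.field 0 bot_le).continuous.inv₀ fun x => (hpos x).ne'⟩
  have hw : φ.field 0 bot_le * w = 1 := ContinuousMap.ext fun x => mul_inv_cancel₀ (hpos x).ne'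
  have key : ∀ q j : ℕ, ∀ hj : (j : ℕ∞) ≤ k, ((j + q : ℕ) : ℕ∞) ≤ k → LeafC q (φ.field j hj) := by
    intro q
    induction q with
    | zero => intros; trivial
    | succ q ih =>
      intro j hj hjq
      have hj1 : ((j + 1 : ℕ) : ℕ∞) ≤ k :=
        le_trans (by exact_mod_cast (by omega : j + 1 ≤ j + (q + 1))) hjq
      refine ⟨φ.field (j + 1) hj1 * w, h.leafDeriv hw fun x => ?_, ?_⟩
      · have h1 := ((φ.smooth.differentiable (j + 1) hj1 x) 0).hasDerivAt
        rw [← iteratedDeriv_succ] at h1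
        refine h1.congr_of_eventuallyEq (Eventually.of_forall fun t => ?_)
        exact (h.iteratedDeriv_orbitCoord j x t).symm
      · refine (ih (j + 1) hj1 (by rwa [show j + 1 + q = j + (q + 1) by omega])).mul
          (LeafC.of_mul_eq_one (ih 0 bot_le ?_) hw)
        exact le_trans (by exact_mod_cast (by omega : 0 + q ≤ j + (q + 1))) hjq
  exact key r 0 bot_le (by rwa [zero_add])

end PosFlow

/-- Convergence of the velocities in `C^k` along the leaves gives uniform convergence of the higher
vector fields up to order `k + 1`. -/
theorem exists_tendsto_vf {φ : ℕ → Flow ℝ (Sol N)} {Φ : Flow ℝ (Sol N)} {v : ℕ → C(Sol N, ℝ)}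
    {V : C(Sol N, ℝ)} (hφ : ∀ n, IsLeafFlow (φ n) (v n)) (hΦ : IsLeafFlow Φ V) {r : ℕ}
    (h : LeafTendsto r v V) {j : ℕ} (hj : j ≤ r) :
    ∃ (u : ℕ → C(Sol N, ℝ)) (U : C(Sol N, ℝ)), (∀ n x, vf (φ n) (j + 1) x = u n x) ∧
      (∀ x, vf Φ (j + 1) x = U x) ∧ LeafTendsto (r - j) u U := by
  induction j with
  | zero => exact ⟨v, V, fun n => (hφ n).vf_one, hΦ.vf_one, h⟩
  | succ j ih =>
    obtain ⟨u, U, hu, hU, hr⟩ := ih (by omega)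
    obtain ⟨q, hq⟩ : ∃ q, r - j = q + 1 := ⟨r - j - 1, by omega⟩
    rw [hq] at hr
    obtain ⟨-, u', U', huu', hUU', hr⟩ := hr
    refine ⟨v * u', V * U', fun n => (hφ n).vf_succ (hu n) (huu' n), hΦ.vf_succ hU hUU', ?_⟩
    rw [show r - (j + 1) = q by omega]
    exact (h.of_le (by omega)).mul hr

theorem tendsto_iSup_abs_sub {u : ℕ → C(Sol N, ℝ)} {U : C(Sol N, ℝ)}
    (h : Tendsto u atTop (𝓝 U)) :
    Tendsto (fun n => ⨆ x, |u n x - U x|) atTop (𝓝 0) := by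
  refine squeeze_zero (fun n => Real.iSup_nonneg fun x => abs_nonneg _)
    (fun n => ciSup_le fun x => ?_) (tendsto_iff_norm_sub_tendsto_zero.1 h)
  exact (u n - U).norm_coe_le_norm x

theorem tendsto_dFin {φ : ℕ → Flow ℝ (Sol N)} {Φ : Flow ℝ (Sol N)} {v : ℕ → C(Sol N, ℝ)}
    {V : C(Sol N, ℝ)} (hφ : ∀ n, IsLeafFlow (φ n) (v n)) (hΦ : IsLeafFlow Φ V) {r : ℕ}
    (h : LeafTendsto r v V) : Tendsto (fun n => dFin (r + 1) (φ n) Φ) atTop (𝓝 0) := by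
  rw [← Finset.sum_const_zero (s := Finset.Icc 1 (r + 1))]
  refine tendsto_finsetSum _ fun j hj => ?_
  obtain ⟨h1, h2⟩ := Finset.mem_Icc.1 hj
  obtain ⟨i, rfl⟩ : ∃ i, j = i + 1 := ⟨j - 1, by omega⟩
  obtain ⟨u, U, hu, hU, hr⟩ := exists_tendsto_vf hφ hΦ h (j := i) (by omega)
  simp only [hu, hU]
  exact tendsto_iSup_abs_sub hr.tendsto

theorem tendsto_posDist {φ : ℕ → Flow ℝ (Sol N)} {Φ : Flow ℝ (Sol N)} {v : ℕ → C(Sol N, ℝ)}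
    {V : C(Sol N, ℝ)} (hφ : ∀ n, IsLeafFlow (φ n) (v n)) (hΦ : IsLeafFlow Φ V) {k : ℕ∞}
    (h : ∀ r : ℕ, (r : ℕ∞) ≤ k → LeafTendsto r v V) :
    Tendsto (fun n => posDist k (φ n) Φ) atTop (𝓝 0) := by
  simp only [posDist]
  split_ifs with hk
  · have hr : ∀ r, Tendsto (fun n => dFin (r + 1) (φ n) Φ) atTop (𝓝 0) := fun r =>
      tendsto_dFin hφ hΦ (h r (hk ▸ le_top))
    have hs : Summable fun r : ℕ => (1 / 2 : ℝ) ^ (r + 1) :=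
      (summable_nat_add_iff 1).2 summable_geometric_two
    have := tendsto_tsum_of_dominated_convergence (𝓕 := atTop) (g := fun _ => (0 : ℝ))
      (f := fun (n : ℕ) (r : ℕ) =>
        (1 / 2 : ℝ) ^ (r + 1) * (dFin (r + 1) (φ n) Φ / (1 + dFin (r + 1) (φ n) Φ))) hs
      (fun r => ?_) (Eventually.of_forall fun n r => ?_)
    · rwa [tsum_zero] at this
    · have h1 := ((hr r).div ((hr r).const_add 1) (by norm_num)).const_mul ((1 / 2 : ℝ) ^ (r + 1))
      simpa using h1
    · have := dFin_nonneg (r + 1) (φ n) Φ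
      rw [Real.norm_of_nonneg (by positivity)]
      refine mul_le_of_le_one_right (by positivity) ?_
      rw [div_le_one (by linarith)]
      linarith
  · exact tendsto_dFin hφ hΦ (h _ (ENat.natCast_toNat hk).le)

/-! ### Convolution with kernels which depend on one coordinate -/

instance : MeasurableSpace (Sol N) := borel _

instance : BorelSpace (Sol N) := ⟨rfl⟩

instance : FirstCountableTopology (Sol N) :=
  Topology.IsInducing.subtypeVal.firstCountableTopology

theorem integrable_haar (f : C(Sol N, ℝ)) : Integrable f haar :=
  f.continuous.integrable_of_hasCompactSupport (HasCompactSupport.of_compactSpace f)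

/-- The convolution `x ↦ ∫ v (x y) K y dy` with respect to Haar measure. -/
def conv (K v : C(Sol N, ℝ)) : C(Sol N, ℝ) where
  toFun x := ∫ y, v (x * y) * K y ∂haar
  continuous_toFun := by
    have h : Continuous (Function.uncurry fun x y : Sol N => v (x * y) * K y) := by
      simp only [Function.uncurry_def]
      fun_prop
    have := continuous_parametric_integral_of_continuous (μ := haar) h isCompact_univ
    simpa using this

theorem conv_apply (K v : C(Sol N, ℝ)) (x : Sol N) : conv K v x = ∫ y, v (x * y) * K y ∂haar := rfl

theorem conv_apply' (K v : C(Sol N, ℝ)) (x : Sol N) :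
    conv K v x = ∫ y, v y * K (x⁻¹ * y) ∂haar := by
  rw [conv_apply, ← integral_mul_left_eq_self (fun y => v y * K (x⁻¹ * y)) x]
  simp

theorem hasDerivAt_integral_haar {F F' : ℝ → Sol N → ℝ} {C : ℝ} (hF : ∀ s, Continuous (F s))
    (hF' : ∀ s, Continuous (F' s)) (hC : ∀ s y, |F' s y| ≤ C)
    (hd : ∀ s y, HasDerivAt (fun s => F s y) (F' s y) s) :
    HasDerivAt (fun s => ∫ y, F s y ∂haar) (∫ y, F' 0 y ∂haar) 0 :=
  (hasDerivAt_integral_of_dominated_loc_of_deriv_le (bound := fun _ => C) univ_mem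
    (Eventually.of_forall fun s => (integrable_haar ⟨F s, hF s⟩).aestronglyMeasurable)
    (integrable_haar ⟨F 0, hF 0⟩) (integrable_haar ⟨F' 0, hF' 0⟩).aestronglyMeasurable
    (Eventually.of_forall fun y s _ => hC s y) (integrable_const C)
    (Eventually.of_forall fun y s _ => hd s y)).2

theorem abs_mul_le_norm_mul (u w : C(Sol N, ℝ)) (x y : Sol N) : |u x * w y| ≤ ‖u‖ * ‖w‖ := by
  rw [abs_mul]
  exact mul_le_mul (u.norm_coe_le_norm x) (w.norm_coe_le_norm y) (abs_nonneg _) (norm_nonneg _)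

theorem LeafDeriv.conv_right {v v' : C(Sol N, ℝ)} (hv : LeafDeriv v v') (K : C(Sol N, ℝ)) :
    LeafDeriv (conv K v) (conv K v') := by
  intro x
  have h := hasDerivAt_integral_haar (F := fun s y => v (x * line N s * y) * K y)
    (F' := fun s y => v' (x * line N s * y) * K y) (C := ‖v'‖ * ‖K‖)
    (fun s => by fun_prop) (fun s => by fun_prop) (fun s y => abs_mul_le_norm_mul _ _ _ _)
    (fun s y => by
      simp only [mul_right_comm x _ y]
      exact (hv.hasDerivAt (x * y) s).mul_const _)
  simp only [line_zero, mul_one] at h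
  exact h

theorem LeafDeriv.conv_left {K K' : C(Sol N, ℝ)} (hK : LeafDeriv K K') (v : C(Sol N, ℝ)) :
    LeafDeriv (conv K v) (-conv K' v) := by
  intro x
  have hx : ∀ s y, (x * line N s)⁻¹ * y = x⁻¹ * y * line N (-s) := fun s y => by
    rw [mul_inv, line_neg, mul_right_comm]
  have h := hasDerivAt_integral_haar (F := fun s y => v y * K ((x * line N s)⁻¹ * y))
    (F' := fun s y => v y * -K' ((x * line N s)⁻¹ * y)) (C := ‖v‖ * ‖-K'‖)
    (fun s => by fun_prop) (fun s => by fun_prop) (fun s y => abs_mul_le_norm_mul v (-K') _ _)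
    (fun s y => by
      simp only [hx]
      refine HasDerivAt.const_mul _ ?_
      have h1 := (hK.hasDerivAt (x⁻¹ * y) (-s)).comp s (hasDerivAt_neg s)
      rw [mul_neg_one] at h1
      exact h1)
  simp only [line_zero, mul_one, mul_neg, integral_neg] at h
  simp only [ContinuousMap.neg_apply, conv_apply']
  exact h

/-- Convolution with a kernel which is differentiable along the leaves gains one derivative. -/
theorem LeafC.conv {K K' : C(Sol N, ℝ)} (hK : LeafDeriv K K') {r : ℕ} {v : C(Sol N, ℝ)}
    (hv : LeafC r v) : LeafC (r + 1) (conv K v) := by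
  induction r generalizing v with
  | zero => exact ⟨_, hK.conv_left v, trivial⟩
  | succ r ih =>
    obtain ⟨v', hv, hr⟩ := hv
    exact ⟨_, hv.conv_right K, ih hr⟩

/-- Convolution with an approximate identity approximates all leaf derivatives at once, because it
commutes with the leaf derivative. -/
theorem LeafC.leafTendsto_conv {K : ℕ → C(Sol N, ℝ)}
    (hK : ∀ v, Tendsto (fun n => SolenoidFlow.conv (K n) v) atTop (𝓝 v)) {r : ℕ} {v : C(Sol N, ℝ)}
    (hv : LeafC r v) : LeafTendsto r (fun n => SolenoidFlow.conv (K n) v) v := by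
  induction r generalizing v with
  | zero => exact hK v
  | succ r ih =>
    obtain ⟨v', hv, hr⟩ := hv
    exact ⟨hK v, _, v', fun n => hv.conv_right (K n), hv, ih hr⟩

/-- If the kernel depends on the `m`-th coordinate only, so does the convolution. -/
theorem conv_mul_left {K : C(Sol N, ℝ)} {m : ℕ}
    (hK : ∀ κ x, coord N m κ = 1 → K (κ * x) = K x) (v : C(Sol N, ℝ)) {κ : Sol N}
    (hκ : coord N m κ = 1) (x : Sol N) : conv K v (κ * x) = conv K v x := by
  simp only [conv_apply', mul_inv, mul_assoc]
  congr 1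
  ext y
  rw [hK _ _ (by rw [map_inv, hκ, inv_one])]

theorem conv_pos {K v : C(Sol N, ℝ)} (hK : ∀ x, 0 ≤ K x) (hK1 : ∫ y, K y ∂haar = 1)
    (hv : ∀ x, 0 < v x) (x : Sol N) : 0 < conv K v x := by
  obtain ⟨x₀, -, hx₀⟩ := isCompact_univ.exists_isMinOn ⟨(1 : Sol N), trivial⟩
    v.continuous.continuousOn
  calc 0 < v x₀ := hv x₀
    _ = ∫ y, v x₀ * K y ∂haar := by rw [integral_const_mul, hK1, mul_one]
    _ ≤ conv K v x := by
      refine integral_mono ((integrable_haar K).const_mul _)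
        (integrable_haar ⟨fun y => v (x * y) * K y, by fun_prop⟩) fun y => ?_
      exact mul_le_mul_of_nonneg_right (hx₀ (Set.mem_univ _)) (hK y)

theorem tendsto_conv {K : ℕ → C(Sol N, ℝ)} (hK : ∀ n x, 0 ≤ K n x)
    (hK1 : ∀ n, ∫ y, K n y ∂haar = 1)
    (hKU : ∀ U ∈ 𝓝 (1 : Sol N), ∀ᶠ n in atTop, ∀ x, K n x ≠ 0 → x ∈ U) (v : C(Sol N, ℝ)) :
    Tendsto (fun n => conv (K n) v) atTop (𝓝 v) := by
  -- Translation, as a continuous map into `C(Sol N, ℝ)`: this is uniform continuity of `v`.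
  let τ : C(Sol N, C(Sol N, ℝ)) :=
    ContinuousMap.curry ⟨fun p : Sol N × Sol N => v (p.2 * p.1), by fun_prop⟩
  have hτ : ∀ x y, τ y x = v (x * y) := fun _ _ => rfl
  rw [Metric.tendsto_atTop']
  intro ε hε
  have hU := (τ.continuous.tendsto 1).eventually (Metric.ball_mem_nhds _ (half_pos hε))
  obtain ⟨n₀, hn₀⟩ := eventually_atTop.1 (hKU _ hU)
  refine ⟨n₀, fun n hn => ?_⟩
  refine lt_of_le_of_lt ?_ (half_lt_self hε)
  rw [ContinuousMap.dist_le (half_pos hε).le]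
  intro x
  have h1 : conv (K n) v x - v x = ∫ y, (v (x * y) - v x) * K n y ∂haar := by
    have h2 : Integrable (fun y => v (x * y) * K n y) haar :=
      integrable_haar ⟨fun y => v (x * y) * K n y, by fun_prop⟩
    simp only [sub_mul]
    rw [integral_sub h2 ((integrable_haar (K n)).const_mul _), integral_const_mul, hK1, mul_one,
      conv_apply]
  rw [Real.dist_eq, h1, ← Real.norm_eq_abs]
  calc ‖∫ y, (v (x * y) - v x) * K n y ∂haar‖ ≤ ∫ y, ε / 2 * K n y ∂haar := by
        refine norm_integral_le_of_norm_le ((integrable_haar (K n)).const_mul _)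
          (Eventually.of_forall fun y => ?_)
        rw [norm_mul, Real.norm_of_nonneg (hK n y)]
        by_cases hy : K n y = 0
        · simp [hy]
        · refine mul_le_mul_of_nonneg_right ?_ (hK n y)
          have h2 := hn₀ n hn.le y hy
          have h3 := (ContinuousMap.norm_coe_le_norm (τ y - τ 1) x)
          rw [ContinuousMap.sub_apply, hτ, hτ, mul_one] at h3
          exact h3.trans (mem_ball_iff_norm.1 h2).le
    _ = ε / 2 := by rw [integral_const_mul, hK1, mul_one]

theorem exists_re_lt_of_mem_nhds_one {W : Set Circle} (hW : W ∈ 𝓝 (1 : Circle)) :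
    ∃ δ > 0, ∀ z : Circle, 1 - δ < (z : ℂ).re → z ∈ W := by
  obtain ⟨ε, hε, hεW⟩ := Metric.mem_nhds_iff.1 hW
  refine ⟨ε ^ 2 / 2, by positivity, fun z hz => hεW ?_⟩
  rw [Metric.mem_ball]
  change dist (z : ℂ) ((1 : Circle) : ℂ) < ε
  rw [dist_eq_norm]
  refine lt_of_pow_lt_pow_left₀ 2 hε.le ?_
  have h1 := Circle.normSq_coe z
  rw [Complex.normSq_apply] at h1
  rw [← Complex.normSq_eq_norm_sq, Complex.normSq_apply]
  simp only [Circle.coe_one, Complex.sub_re, Complex.one_re, Complex.sub_im, Complex.one_im]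
  nlinarith

/-- The real part of a coordinate. -/
def coordRe (N : BondSeq) (m : ℕ) : C(Sol N, ℝ) :=
  ⟨fun x => ((coord N m x : Circle) : ℂ).re,
    Complex.continuous_re.comp (continuous_subtype_val.comp (continuous_coord m))⟩

/-- The imaginary part of a coordinate. -/
def coordIm (N : BondSeq) (m : ℕ) : C(Sol N, ℝ) :=
  ⟨fun x => ((coord N m x : Circle) : ℂ).im,
    Complex.continuous_im.comp (continuous_subtype_val.comp (continuous_coord m))⟩

theorem hasDerivAt_coordRe (m : ℕ) (x : Sol N) :
    HasDerivAt (fun s => coordRe N m (x * line N s))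
      (-(coordIm N m x * (2 * Real.pi / period N m))) 0 := by
  have h1 : ∀ s, coordRe N m (x * line N s) =
      coordRe N m x * Real.cos (s * (2 * Real.pi / period N m)) -
        coordIm N m x * Real.sin (s * (2 * Real.pi / period N m)) := by
    intro s
    change ((coord N m (x * line N s) : Circle) : ℂ).re = _
    rw [map_mul, coord_line, Circle.coe_mul, Complex.mul_re, Circle.coe_exp,
      Complex.exp_ofReal_mul_I_re, Complex.exp_ofReal_mul_I_im, mul_div_right_comm,
      mul_comm _ s]
    rfl
  have h2 : HasDerivAt (fun s : ℝ => s * (2 * Real.pi / period N m))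
      (2 * Real.pi / period N m) 0 := by
    simpa using (hasDerivAt_id (0 : ℝ)).mul_const (2 * Real.pi / period N m)
  refine (((h2.cos.const_mul (coordRe N m x)).sub
    (h2.sin.const_mul (coordIm N m x))).congr_of_eventuallyEq
      (Eventually.of_forall h1)).congr_deriv ?_
  simp

/-- The bump is a smooth cut-off of the real part of a coordinate. Its derivative along the leaves
is therefore explicit. -/
theorem exists_bump {U : Set (Sol N)} (hU : U ∈ 𝓝 (1 : Sol N)) :
    ∃ (m : ℕ) (K K' : C(Sol N, ℝ)), LeafDeriv K K' ∧ (∀ x, 0 ≤ K x) ∧ 0 < K 1 ∧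
      (∀ κ x, coord N m κ = 1 → K (κ * x) = K x) ∧ ∀ x, K x ≠ 0 → x ∈ U := by
  obtain ⟨m, W, hW, hWU⟩ := exists_coord_mem_of_mem_nhds_one hU
  obtain ⟨δ, hδ, hδW⟩ := exists_re_lt_of_mem_nhds_one hW
  have hf : ContDiff ℝ 1 Real.smoothTransition := Real.smoothTransition.contDiff
  have hf' : Continuous (deriv Real.smoothTransition) := hf.continuous_deriv le_rfl
  refine ⟨m, ⟨fun x => Real.smoothTransition (coordRe N m x - (1 - δ)),
      hf.continuous.comp (by fun_prop)⟩,
    ⟨fun x => deriv Real.smoothTransition (coordRe N m x - (1 - δ)) *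
      -(coordIm N m x * (2 * Real.pi / period N m)),
      (hf'.comp (by fun_prop)).mul (by fun_prop)⟩, fun x => ?_, fun x => ?_, ?_, fun κ x hκ => ?_,
    fun x hx => ?_⟩
  · have h1 := (hasDerivAt_coordRe m x).sub_const (1 - δ)
    have h2 := ((hf.differentiable one_ne_zero).differentiableAt
      (x := coordRe N m (x * line N 0) - (1 - δ))).hasDerivAt.comp (0 : ℝ) h1
    rwa [line_zero, mul_one] at h2
  · exact Real.smoothTransition.nonneg _
  · refine Real.smoothTransition.pos_of_pos ?_
    simp [coordRe, hδ]
  · simp [coordRe, hκ]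
  · refine hWU x (hδW _ ?_)
    by_contra! h
    exact hx (Real.smoothTransition.zero_of_nonpos (sub_nonpos.2 h))

/-- There is an approximate identity whose kernels are differentiable along the leaves and depend
on one coordinate only. -/
theorem exists_approximate_identity (N : BondSeq) :
    ∃ (m : ℕ → ℕ) (K K' : ℕ → C(Sol N, ℝ)), (∀ n, LeafDeriv (K n) (K' n)) ∧
      (∀ n x, 0 ≤ K n x) ∧ (∀ n, ∫ y, K n y ∂haar = 1) ∧
      (∀ n κ x, coord N (m n) κ = 1 → K n (κ * x) = K n x) ∧
      ∀ U ∈ 𝓝 (1 : Sol N), ∀ᶠ n in atTop, ∀ x, K n x ≠ 0 → x ∈ U := by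
  obtain ⟨U, hU⟩ := (𝓝 (1 : Sol N)).exists_antitone_basis
  choose m K K' hd h0 h1 hm hs using fun n => exists_bump (hU.1.mem_of_mem (i := n) trivial)
  have hpos : ∀ n, 0 < ∫ y, K n y ∂haar := fun n =>
    (K n).continuous.integral_pos_of_hasCompactSupport_nonneg_nonzero
      (HasCompactSupport.of_compactSpace _) (h0 n) (h1 n).ne'
  refine ⟨m, fun n => (∫ y, K n y ∂haar)⁻¹ • K n, fun n => (∫ y, K n y ∂haar)⁻¹ • K' n,
    fun n x => (hd n x).const_mul _, fun n x => ?_, fun n => ?_, fun n κ x hκ => ?_,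
    fun V hV => ?_⟩
  · exact mul_nonneg (inv_nonneg.2 (hpos n).le) (h0 n x)
  · simp only [ContinuousMap.smul_apply, smul_eq_mul]
    rw [integral_const_mul, inv_mul_cancel₀ (hpos n).ne']
  · simp only [ContinuousMap.smul_apply, hm n κ x hκ]
  · filter_upwards [hU.eventually_subset hV] with n hn x hx
    exact hn (hs n x fun h => hx (by simp [h]))

/-! ### Almost periodic flows whose velocity depends on one coordinate -/

/-- The function on the solenoid induced, through the `m`-th coordinate, by a periodic function on
the line. -/
def periodicLift (m : ℕ) (h : C(ℝ, ℝ)) (hp : Function.Periodic h (period N m)) : C(Sol N, ℝ) where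
  toFun x := h (period N m / (2 * Real.pi) * (coord N m x : ℂ).arg)
  continuous_toFun := by
    -- It suffices to check continuity after composition with the quotient map `Circle.exp`, where
    -- the jumps of the argument are invisible to the periodic function `h`.
    have hq : IsQuotientMap Circle.exp :=
      isLocalHomeomorph_circleExp.isOpenMap.isQuotientMap Circle.exp.continuous
        fun z => ⟨_, Circle.exp_arg z⟩
    have hz : Continuous fun z : Circle => h (period N m / (2 * Real.pi) * (z : ℂ).arg) := by
      rw [hq.continuous_iff]
      have : ((fun z : Circle => h (period N m / (2 * Real.pi) * (z : ℂ).arg)) ∘ Circle.exp) =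
          fun θ => h (period N m / (2 * Real.pi) * θ) := by
        funext θ
        obtain ⟨n, hn⟩ := Circle.exp_eq_exp.1 (Circle.exp_arg (Circle.exp θ))
        have h1 : period N m / (2 * Real.pi) * (θ + n * (2 * Real.pi)) =
            period N m / (2 * Real.pi) * θ + n * period N m := by
          have := Real.pi_pos
          field_simp
        simp only [Function.comp, hn, h1]
        exact hp.int_mul n _
      rw [this]
      fun_prop
    exact hz.comp (continuous_coord m)

theorem periodicLift_apply {m : ℕ} {h : C(ℝ, ℝ)} {hp : Function.Periodic h (period N m)}
    {κ : Sol N} (hκ : coord N m κ = 1) (t : ℝ) : periodicLift m h hp (line N t * κ) = h t := by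
  have hP := period_pos (N := N) m
  have hpi := Real.pi_pos
  have h0 : coord N m (line N t * κ) = Circle.exp (2 * Real.pi * t / period N m) := by
    rw [map_mul, hκ, mul_one, coord_line]
  obtain ⟨n, hn⟩ := Circle.exp_eq_exp.1
    ((Circle.exp_arg (coord N m (line N t * κ))).trans h0)
  have h1 : period N m / (2 * Real.pi) * (2 * Real.pi * t / period N m + n * (2 * Real.pi)) =
      t + n * period N m := by
    field_simp
  rw [← hn] at h1
  exact (congrArg h h1).trans (hp.int_mul n t)

theorem periodic_sub_id {f : C(ℝ, ℝ)} {P : ℝ} (hf : ∀ t, f (t + P) = f t + P) :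
    Function.Periodic (f - ContinuousMap.id ℝ) P := fun t => by simp [hf]

/-- The map of the solenoid which acts on the leaves, parameterized from a point of the kernel of
the `m`-th coordinate, as a lift `f` of a circle map of degree one. -/
def leafMap (m : ℕ) (f : C(ℝ, ℝ)) (hf : ∀ t, f (t + period N m) = f t + period N m) :
    C(Sol N, Sol N) where
  toFun x := x * line N (periodicLift m (f - ContinuousMap.id ℝ) (periodic_sub_id hf) x)
  continuous_toFun := continuous_id.mul (continuous_line.comp (map_continuous _))

theorem leafMap_apply {m : ℕ} {f : C(ℝ, ℝ)} {hf : ∀ t, f (t + period N m) = f t + period N m}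
    {κ : Sol N} (hκ : coord N m κ = 1) (t : ℝ) :
    leafMap m f hf (line N t * κ) = line N (f t) * κ := by
  change line N t * κ * line N _ = _
  rw [periodicLift_apply hκ, mul_right_comm, ← line_add]
  simp

theorem symm_add_period {θ : ℝ ≃ₜ ℝ} {P : ℝ} (h : ∀ t, θ (t + P) = θ t + P) (t : ℝ) :
    θ.symm (t + P) = θ.symm t + P := by
  rw [Homeomorph.symm_apply_eq, h, θ.apply_symm_apply]

/-- The linear flow with speed `a`, conjugated by the leaf map of `θ`. -/
def conjFlow (m : ℕ) (θ : ℝ ≃ₜ ℝ) (hθ : ∀ t, θ (t + period N m) = θ t + period N m) (a : ℝ) :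
    Flow ℝ (Sol N) where
  toFun t x := leafMap m θ.symm (symm_add_period hθ) (line N (a * t) * leafMap m θ hθ x)
  cont' := by
    have := continuous_line (N := N)
    simp only [Function.uncurry_def]
    fun_prop
  map_add' s t x := by
    obtain ⟨t₀, κ, hκ, rfl⟩ := exists_line_mul m x
    simp only [leafMap_apply hκ, ← mul_assoc, ← line_add, ContinuousMap.coe_coe,
      Homeomorph.apply_symm_apply]
    congr 3; ring
  map_zero' x := by
    obtain ⟨t₀, κ, hκ, rfl⟩ := exists_line_mul m x
    simp only [leafMap_apply hκ, mul_zero, line_zero, one_mul, ContinuousMap.coe_coe,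
      Homeomorph.symm_apply_apply]

theorem conjFlow_apply {m : ℕ} {θ : ℝ ≃ₜ ℝ} (hθ : ∀ t, θ (t + period N m) = θ t + period N m)
    (a t : ℝ) (x : Sol N) : conjFlow m θ hθ a t x =
      leafMap m θ.symm (symm_add_period hθ) (line N (a * t) * leafMap m θ hθ x) := rfl

theorem conjFlow_line {m : ℕ} {θ : ℝ ≃ₜ ℝ} (hθ : ∀ t, θ (t + period N m) = θ t + period N m)
    (a t t₀ : ℝ) {κ : Sol N} (hκ : coord N m κ = 1) :
    conjFlow m θ hθ a t (line N t₀ * κ) = line N (θ.symm (a * t + θ t₀)) * κ := by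
  simp only [conjFlow_apply, leafMap_apply hκ, ← mul_assoc, ← line_add, ContinuousMap.coe_coe]

theorem isLeafFlow_conjFlow {m : ℕ} {θ : ℝ ≃ₜ ℝ}
    (hθ : ∀ t, θ (t + period N m) = θ t + period N m) {a : ℝ} {w : C(Sol N, ℝ)}
    (hw0 : ∀ x, 0 < w x) (hw : ∀ κ x, coord N m κ = 1 → w (κ * x) = w x)
    (hd : ∀ t, HasDerivAt θ (a * (w (line N t))⁻¹) t) (ha : 0 < a) :
    IsLeafFlow (conjFlow m θ hθ a) w := by
  have h1 : ∀ t₀ κ, coord N m κ = 1 → ∀ t, conjFlow m θ hθ a t (line N t₀ * κ) =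
      line N (θ.symm (a * t + θ t₀) - t₀) * (line N t₀ * κ) := by
    intro t₀ κ hκ t
    rw [conjFlow_line hθ a t t₀ hκ, ← mul_assoc, ← line_add, sub_add_cancel]
  refine ⟨fun x t => ?_, fun x => ?_⟩
  · obtain ⟨t₀, κ, hκ, rfl⟩ := exists_line_mul m x
    exact line_orbitCoord ⟨_, h1 t₀ κ hκ t⟩
  · obtain ⟨t₀, κ, hκ, rfl⟩ := exists_line_mul m x
    have h2 : orbitCoord (conjFlow m θ hθ a) (line N t₀ * κ) =
        fun t => θ.symm (a * t + θ t₀) - t₀ := funext fun t => orbitCoord_eq (h1 t₀ κ hκ t)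
    have h3 : θ.symm (a * 0 + θ t₀) = t₀ := by simp
    have hne : a * (w (line N t₀))⁻¹ ≠ 0 := (mul_pos ha (inv_pos.2 (hw0 _))).ne'
    have h4 : HasDerivAt θ.symm (a * (w (line N t₀))⁻¹)⁻¹ (a * 0 + θ t₀) :=
      HasDerivAt.of_local_left_inverse θ.symm.continuous.continuousAt
        (by rw [h3]; exact hd t₀) hne (Eventually.of_forall θ.apply_symm_apply)
    have h5 : HasDerivAt (fun t => a * t + θ t₀) a 0 := by
      simpa using ((hasDerivAt_id (0 : ℝ)).const_mul a).add_const (θ t₀)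
    rw [h2]
    refine ((h4.comp 0 h5).sub_const t₀).congr_deriv ?_
    rw [mul_comm (line N t₀), hw κ _ hκ]
    have := hw0 (line N t₀)
    field_simp

/-- A flow conjugate to a linear flow is almost periodic: a translation by a multiple of a large
period is close to the identity, and the conjugacy is uniformly continuous. -/
theorem almostPeriodic_conjFlow {m : ℕ} {θ : ℝ ≃ₜ ℝ}
    (hθ : ∀ t, θ (t + period N m) = θ t + period N m) {a : ℝ} (ha : 0 < a) :
    AlmostPeriodic (conjFlow m θ hθ a) := by
  intro U hU
  have huc : UniformContinuous (leafMap m θ.symm (symm_add_period hθ)) :=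
    CompactSpace.uniformContinuous_of_continuous (map_continuous _)
  have hV := huc hU
  rw [uniformity_eq_comap_nhds_one (Sol N)] at hV
  obtain ⟨O, hO, hOV⟩ := hV
  obtain ⟨q, W, hW, hWO⟩ := exists_coord_mem_of_mem_nhds_one hO
  have hL : 0 < period N q / a := div_pos (period_pos q) ha
  refine ⟨period N q / a, hL, fun b => ⟨⌈b / (period N q / a)⌉ * (period N q / a), ⟨?_, ?_⟩,
    fun x => ?_⟩⟩
  · rw [← div_le_iff₀ hL]
    exact Int.le_ceil _
  · have := (Int.ceil_lt_add_one (b / (period N q / a))).le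
    calc (⌈b / (period N q / a)⌉ : ℝ) * (period N q / a)
        ≤ (b / (period N q / a) + 1) * (period N q / a) := by gcongr
      _ = b + period N q / a := by rw [add_mul, one_mul, div_mul_cancel₀ _ hL.ne']
  · set τ := (⌈b / (period N q / a)⌉ : ℝ) * (period N q / a) with hτ
    have h1 : coord N q (line N (a * τ)) = 1 := by
      rw [← map_one (coord N q), ← line_zero, coord_line_eq_iff]
      exact ⟨⌈b / (period N q / a)⌉, by rw [hτ]; field_simp; ring⟩
    have h2 : (leafMap m θ hθ x, line N (a * τ) * leafMap m θ hθ x) ∈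
        (fun p : Sol N × Sol N => p.2 / p.1) ⁻¹' O := by
      simp only [Set.mem_preimage, mul_div_cancel_right]
      exact hWO _ (by rw [h1]; exact mem_of_mem_nhds hW)
    have h3 := hOV h2
    simp only [Set.mem_preimage] at h3
    have h4 : leafMap m θ.symm (symm_add_period hθ) (leafMap m θ hθ x) = x := by
      have := (conjFlow m θ hθ a).map_zero_apply x
      rwa [conjFlow_apply, mul_zero, line_zero, one_mul] at this
    rwa [h4] at h3

/-- A positive velocity which depends on one coordinate is periodic along the one-parameter
subgroup, and the time needed to travel along the leaves is a linear function of the position up to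
a periodic function. Hence the flow is conjugate to a linear flow. -/
theorem exists_almostPeriodic_isLeafFlow {m : ℕ} {w : C(Sol N, ℝ)} (hw0 : ∀ x, 0 < w x)
    (hw : ∀ κ x, coord N m κ = 1 → w (κ * x) = w x) :
    ∃ φ : Flow ℝ (Sol N), IsLeafFlow φ w ∧ AlmostPeriodic φ := by
  have hP := period_pos (N := N) m
  let g : ℝ → ℝ := fun t => (w (line N t))⁻¹
  have hg0 : ∀ t, 0 < g t := fun t => inv_pos.2 (hw0 _)
  have hgc : Continuous g := (w.continuous.comp continuous_line).inv₀ fun t => (hw0 _).ne'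
  have hgp : Function.Periodic g (period N m) := by
    intro t
    have h1 : coord N m (line N (period N m)) = 1 := by
      rw [← map_one (coord N m), ← line_zero, coord_line_eq_iff]
      exact ⟨1, by simp⟩
    simp only [g]
    rw [add_comm, line_add, hw _ _ h1]
  have hgi : ∀ a b, IntervalIntegrable g volume a b := fun a b => hgc.intervalIntegrable a b
  let T : ℝ → ℝ := fun t => ∫ u in (0 : ℝ)..t, g u
  have hTd : ∀ t, HasDerivAt T (g t) t := fun t => hgc.integral_hasStrictDerivAt 0 t |>.hasDerivAt
  have hTP : 0 < T (period N m) :=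
    intervalIntegral.intervalIntegral_pos_of_pos (hgi _ _) hg0 hP
  have hTadd : ∀ t, T (t + period N m) = T t + T (period N m) := by
    intro t
    have h1 := hgp.intervalIntegral_add_eq t 0
    rw [zero_add] at h1
    simp only [T]
    rw [← h1, intervalIntegral.integral_add_adjacent_intervals (hgi _ _) (hgi _ _)]
  -- The normalization makes `a * T` commute with the translation by the period.
  let a := period N m / T (period N m)
  have ha : 0 < a := div_pos hP hTP
  have hd : ∀ t, HasDerivAt (fun t => a * T t) (a * g t) t := fun t => (hTd t).const_mul a
  have hmono : StrictMono fun t => a * T t := strictMono_of_deriv_pos fun t => by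
    rw [(hd t).deriv]
    exact mul_pos ha (hg0 t)
  have hsurj : Function.Surjective fun t => a * T t := by
    refine Continuous.surjective (continuous_iff_continuousAt.2 fun t => (hd t).continuousAt) ?_ ?_
    · exact (hgp.tendsto_atTop_intervalIntegral_of_pos' (hgi _ _) hg0 hP).const_mul_atTop ha
    · exact (hgp.tendsto_atBot_intervalIntegral_of_pos' (hgi _ _) hg0 hP).const_mul_atBot ha
  let θ : ℝ ≃ₜ ℝ := (hmono.orderIsoOfSurjective _ hsurj).toHomeomorph
  have hθ : ∀ t, θ (t + period N m) = θ t + period N m := by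
    intro t
    change a * T (t + period N m) = a * T t + period N m
    rw [hTadd, mul_add, div_mul_cancel₀ _ hTP.ne']
  exact ⟨conjFlow m θ hθ a, isLeafFlow_conjFlow hθ hw0 hw hd ha, almostPeriodic_conjFlow hθ ha⟩

/-- Every flow with positive vector field is a limit of almost periodic ones. -/
theorem exists_seq_almostPeriodic {k : ℕ∞} {α : ℝ≥0} (hα : α ≤ 1) (Φ : PosFlow N k α) :
    ∃ φ : ℕ → PosFlow N k α, (∀ n, AlmostPeriodic (φ n).flow) ∧ Tendsto φ atTop (𝓝 Φ) := by
  obtain ⟨m, K, K', hd, h0, h1, hm, hU⟩ := exists_approximate_identity N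
  set V := Φ.field 0 bot_le with hV
  have hpos : ∀ n x, 0 < conv (K n) V x := fun n => conv_pos (h0 n) (h1 n) Φ.pos
  choose φ hφ hap using fun n => exists_almostPeriodic_isLeafFlow (hpos n)
    fun κ x hκ => conv_mul_left (hm n) V hκ x
  refine ⟨fun n => ⟨φ n, (hφ n).isSmooth (fun r hr => (Φ.leafC hr).conv (hd n)) hα,
    fun x => by rw [(hφ n).vf_one]; exact hpos n x⟩, hap, ?_⟩
  rw [tendsto_iff_dist_tendsto_zero]
  exact tendsto_posDist hφ Φ.isLeafFlow fun r hr =>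
    (Φ.leafC hr).leafTendsto_conv (tendsto_conv h0 h1 hU)

end SolenoidFlow

end

theorem mainTheorem3 (N : SolenoidFlow.BondSeq) (k : ℕ∞) (α : ℝ≥0) (hα : α ≤ 1) :
    Dense {φ : SolenoidFlow.PosFlow N k α | SolenoidFlow.AlmostPeriodic φ.flow} := by
  intro Φ
  obtain ⟨φ, hap, hφ⟩ := SolenoidFlow.exists_seq_almostPeriodic hα Φ
  exact mem_closure_of_tendsto hφ (Filter.Eventually.of_forall hap)
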